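/- **Setting.** Graphs are finite, simple and connected, and their nodes carry unique identifiers (natural numbers) encoded using $O(\log n)$ bits, where $n$ is the number of nodes; precisely, for a fixed constant $c$, every identifier in an $n$-node graph has at most $c(\lfloor\log_2 n\rfloor+1)$ bits. A *configuration family* $(\mathcal G,\mathcal I)$ is given by a family $\mathcal G$ of such graphs and a set $\mathcal I$ of binary strings; its configurations are the pairs $(G,I)$ with $G\in\mathcal G$ and $I:V(G)\to\mathcal I$. A *predicate* $P$ on $(\mathcal G,\mathcal I)$ is a set of configurations. For a radius $r=r(n)$, an *$r$-hop proof labeling scheme* ($r$-PLS) for $P$ is a pair $(\mathrm{Prov},\mathrm{Ver})$. The prover $\mathrm{Prov}$ assigns to each $(G,I)\in P$ a labeling $\mathrm{Prov}(G,I):V(G)\to\{0,1\}^*$. The verifier $\mathrm{Ver}$ accepts or rejects at a node $v$ as a function of $n=|V(G)|$, of $v$, and of the $r(n)$-hop neighborhood $B_{r(n)}(v)$ of $v$ with its identifiers, induced edges, inputs and labels. It is required that * (completeness) if $(G,I)\in P$, all nodes accept under the labeling $\mathrm{Prov}(G,I)$; * (soundness) if, for a configuration $(G,I)$ and some labeling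 $\ell:V(G)\to\{0,1\}^*$, all nodes accept, then $(G,I)\in P$. The *cost* of the scheme, as a function of $n$, is the maximum of $|\mathrm{Prov}(G,I)(v)|$ over all $(G,I)\in P$ with $|V(G)|=n$ and all $v\in V(G)$. **Theorem.** Let $(\mathcal G,\mathcal I)$ be a configuration family and $P$ a predicate on it. If there is a $1$-PLS for $P$ with cost at most $p=p(n)$, then for every integer $t=t(n)\ge 1$ there is an $O(t\log n)$-PLS for $P$ with cost $O(\lceil p/t\rceil)$. Precisely: for every $c$ there is a constant $K\in\mathbb N$, depending only on $c$, such that for all $(\mathcal G,\mathcal I)$, $P$, $p:\mathbb N\to\mathbb N$ and $t:\mathbb N\to\mathbb N_{\ge1}$ as above there is an $r$-PLS for $P$ with $r(n)=K\,t(n)\lfloor\log_2 n\rfloor$ whose cost is at most $K\lceil p(n)/t(n)\rceil$ for every $n$. -/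

import Mathlib

/-- Finite binary strings, used for inputs and for labels. -/
abbrev BitString := List Bool

/-- A finite graph whose nodes carry unique identifiers: a node is its identifier. -/
structure NetGraph where
  /-- the nodes -/
  verts : Finset ℕ
  /-- the edges -/
  graph : SimpleGraph verts

/-- The number `n` of nodes. -/
def NetGraph.size (G : NetGraph) : ℕ := G.verts.card

/-- All identifiers are encoded by at most `c * (⌊log₂ n⌋ + 1)` bits. -/
def NetGraph.IdBitsLE (G : NetGraph) (c : ℕ) : Prop :=
  ∀ v ∈ G.verts, Nat.size v ≤ c * (Nat.log 2 G.size + 1)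

/-- A graph together with an assignment of input strings to its nodes. -/
structure Config where
  net : NetGraph
  input : net.verts → BitString

/-- The configurations with graph in `𝒢` and all inputs in `ℐ`. -/
def configs (𝒢 : Set NetGraph) (ℐ : Set BitString) : Set Config :=
  {C | C.net ∈ 𝒢 ∧ ∀ v, C.input v ∈ ℐ}

/-- The nodes of a configuration. -/
abbrev Config.Node (C : Config) : Type := C.net.verts

/-- The nodes at distance at most `r` from `v`. The extended distance is used, so that nodes in
other connected components are at distance `⊤`. -/
def Config.ball (C : Config) (r : ℕ) (v : C.Node) : Set C.Node :=
  {u | C.net.graph.edist v u ≤ (r : ℕ∞)}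

/-- What a node knows when it decides: the number of nodes of the graph, its own identifier, and,
within its ball, the nodes (identifiers), the induced edges, the inputs and the labels. -/
structure View where
  size : ℕ
  center : ℕ
  nodes : Set ℕ
  adj : ℕ → ℕ → Prop
  /-- `none` outside the ball -/
  input : ℕ → Option BitString
  /-- `none` outside the ball -/
  label : ℕ → Option BitString

open Classical in
/-- The information in the `r`-hop neighbourhood of `v` under the labelling `l`. -/
noncomputable def Config.view (C : Config) (l : C.Node → BitString) (r : ℕ) (v : C.Node) : View where
  size := C.net.size
  center := v
  nodes := Subtype.val '' C.ball r v
  adj := fun a b => ∃ x ∈ C.ball r v, ∃ y ∈ C.ball r v,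
    (x : ℕ) = a ∧ (y : ℕ) = b ∧ C.net.graph.Adj x y
  input := fun a =>
    if h : ∃ x ∈ C.ball r v, (x : ℕ) = a then some (C.input h.choose) else none
  label := fun a =>
    if h : ∃ x ∈ C.ball r v, (x : ℕ) = a then some (l h.choose) else none

/-- A proof labeling scheme for the predicate `P` on the configurations over `(𝒢, ℐ)`, in which
a node of an `n`-node graph sees its `r n`-hop neighbourhood. The values of `prov` outside `P`
play no role. -/
structure PLS {𝒢 : Set NetGraph} {ℐ : Set BitString} (P : configs 𝒢 ℐ → Prop) (r : ℕ → ℕ) where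
  /-- the honest prover -/
  prov : (C : configs 𝒢 ℐ) → C.1.Node → BitString
  /-- the verifier: it accepts a view if the proposition holds -/
  ver : View → Prop
  completeness : ∀ C : configs 𝒢 ℐ, P C →
    ∀ v : C.1.Node, ver (C.1.view (prov C) (r C.1.net.size) v)
  soundness : ∀ (C : configs 𝒢 ℐ) (l : C.1.Node → BitString),
    (∀ v : C.1.Node, ver (C.1.view l (r C.1.net.size) v)) → P C

/-- The cost on `n`-node graphs: the largest length of a label which the honest prover assigns in
a configuration that satisfies `P` (`⊤` if these lengths are unbounded). -/
noncomputable def PLS.cost {𝒢 : Set NetGraph} {ℐ : Set BitString} {P : configs 𝒢 ℐ → Prop}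
    {r : ℕ → ℕ} (S : PLS P r) (n : ℕ) : ℕ∞ :=
  ⨆ (C : configs 𝒢 ℐ) (_ : P C ∧ C.1.net.size = n) (v : C.1.Node), ((S.prov C v).length : ℕ∞)

/-!
Cluster the graph by ball growing: around the smallest remaining node, some radius in `O(t log n)`
gives a ball that grows by a factor of at most `1 + 1 / t` in the next two steps, since otherwise it
would exceed `n` nodes. Cut the graph at such a ball and repeat. Then every cluster has at least `t`
nodes for each node near its border, so the `1`-hop certificates of the border nodes fit into the
cluster with only `⌈p / t⌉` bits per node. One more bit marks the outermost layer of each ball. A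
walk that never enters a marked node cannot enter a ball that was cut off before that of its start,
and the centres increase, so the smallest node within reach is the centre of the cluster. In this
way every node recovers its cluster from the marks alone.

A node accepts if its view of radius `O(t log n)` occurs in an honestly labelled configuration of
`P`. If all nodes accept, then each cluster can adopt the `1`-hop certificates of the configuration
seen by its leader, and the certificates stored in the labels force neighbouring clusters to agree
on the border nodes. Hence the `1`-hop scheme accepts as well.
-/

/-- The nodes at distance at most `r` from `v`; unlike in `SimpleGraph.ball`, the inequality is not
strict. -/
def closedBall {V : Type*} (G : SimpleGraph V) (v : V) (r : ℕ) : Set V :=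
  {x | G.edist v x ≤ (r : ℕ∞)}

section ClosedBall

variable {V : Type*} {G : SimpleGraph V} {u v w x : V} {i j k : ℕ}

theorem mem_closedBall : x ∈ closedBall G v k ↔ G.edist v x ≤ (k : ℕ∞) := Iff.rfl

theorem mem_closedBall_self : v ∈ closedBall G v k := by simp [closedBall]

theorem mem_closedBall_comm : u ∈ closedBall G v k ↔ v ∈ closedBall G u k := by
  rw [mem_closedBall, mem_closedBall, SimpleGraph.edist_comm]

theorem closedBall_zero : closedBall G v 0 = {v} := by
  ext x
  simp [mem_closedBall, SimpleGraph.edist_eq_zero_iff, eq_comm (a := x)]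

theorem closedBall_mono (h : i ≤ j) : closedBall G v i ⊆ closedBall G v j :=
  fun _ hx => (mem_closedBall.mp hx).trans (by exact_mod_cast h)

theorem mem_closedBall_add (hv : v ∈ closedBall G u i) (hw : w ∈ closedBall G v j) :
    w ∈ closedBall G u (i + j) := by
  rw [mem_closedBall, Nat.cast_add]
  exact SimpleGraph.edist_triangle.trans (add_le_add hv hw)

theorem mem_closedBall_one_of_adj (h : G.Adj u v) : v ∈ closedBall G u 1 := by
  simpa [closedBall] using (SimpleGraph.edist_eq_one_iff_adj.mpr h).le

theorem mem_closedBall_succ :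
    x ∈ closedBall G v (k + 1) ↔ ∃ w ∈ closedBall G v k, w = x ∨ G.Adj w x := by
  constructor
  · intro hx
    obtain ⟨p, hp⟩ :=
      G.exists_walk_of_edist_ne_top (ne_top_of_le_ne_top (ENat.natCast_ne_top _) hx)
    have hlen : p.length ≤ k + 1 := by exact_mod_cast hp.trans_le hx
    by_cases hnil : p.Nil
    · exact ⟨x, hnil.eq ▸ mem_closedBall_self, Or.inl rfl⟩
    · have hdrop := p.length_dropLast_add_one hnil
      exact ⟨p.penultimate, (G.edist_le p.dropLast).trans (by exact_mod_cast (by omega)),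
        Or.inr (p.adj_penultimate hnil)⟩
  · rintro ⟨w, hw, rfl | hadj⟩
    · exact closedBall_mono k.le_succ hw
    · exact mem_closedBall_add hw (mem_closedBall_one_of_adj hadj)

theorem mem_closedBall_one : x ∈ closedBall G v 1 ↔ v = x ∨ G.Adj v x := by
  simp [mem_closedBall_succ (k := 0), closedBall_zero]

theorem closedBall_subset_support (hv : v ∈ G.support) : closedBall G v k ⊆ G.support := by
  induction k with
  | zero => simpa [closedBall_zero] using hv
  | succ k ih =>
    intro x hx
    obtain ⟨w, hw, rfl | hadj⟩ := mem_closedBall_succ.mp hx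
    · exact ih hw
    · exact hadj.mem_support_right

theorem closedBall_map {W : Type*} (f : V ↪ W) :
    closedBall (G.map f) (f v) k = f '' closedBall G v k := by
  induction k with
  | zero => simp [closedBall_zero]
  | succ k ih =>
    ext x
    rw [mem_closedBall_succ, ih]
    constructor
    · rintro ⟨_, ⟨w, hw, rfl⟩, rfl | hadj⟩
      · exact ⟨w, closedBall_mono k.le_succ hw, rfl⟩
      · obtain ⟨-, a, y, hay, ha, rfl⟩ := hadj
        exact ⟨y, mem_closedBall_succ.mpr ⟨w, hw, Or.inr (f.injective ha ▸ hay)⟩, rfl⟩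
    · rintro ⟨y, hy, rfl⟩
      obtain ⟨w, hw, hwy⟩ := mem_closedBall_succ.mp hy
      exact ⟨f w, ⟨w, hw, rfl⟩, hwy.imp (congrArg f) SimpleGraph.map_adj_apply.mpr⟩

end ClosedBall

/-- A graph with a set of marked nodes. The marks are the only trace of a clustering of the graph
that the labels carry; everything else about the clustering is recomputed from them locally. -/
structure MarkedGraph (V : Type*) where
  graph : SimpleGraph V
  marks : Set V

namespace MarkedGraph

section Reach

variable {V : Type*} (H : MarkedGraph V)

/-- The nodes which a walk of length at most `k` from `u` can reach without entering a marked node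
after its start. -/
def reach (u : V) : ℕ → Set V
  | 0 => {u}
  | k + 1 => reach u k ∪ {x | x ∉ H.marks ∧ ∃ w ∈ reach u k, H.graph.Adj w x}

variable {H} {u w : V} {j k : ℕ}

theorem reach_mono (h : j ≤ k) : H.reach u j ⊆ H.reach u k :=
  monotone_nat_of_le_succ (fun _ => Set.subset_union_left) h

theorem mem_reach_self : u ∈ H.reach u k := reach_mono k.zero_le rfl

theorem reach_subset_closedBall : H.reach u k ⊆ closedBall H.graph u k := by
  induction k with
  | zero => exact closedBall_zero.ge
  | succ k ih =>
    rintro x (hx | ⟨-, w, hw, hadj⟩)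
    · exact closedBall_mono k.le_succ (ih hx)
    · exact mem_closedBall_succ.mpr ⟨w, ih hw, Or.inr hadj⟩

theorem reach_subset_reach_succ_of_adj (hadj : H.graph.Adj u w) (hw : w ∉ H.marks) :
    H.reach w k ⊆ H.reach u (k + 1) := by
  induction k with
  | zero =>
    rintro _ rfl
    exact Or.inr ⟨hw, u, rfl, hadj⟩
  | succ k ih =>
    rintro x (hx | ⟨hxM, y, hy, hyx⟩)
    · exact Or.inl (ih hx)
    · exact Or.inr ⟨hxM, y, ih hy, hyx⟩

theorem reach_subset_insert_support : H.reach u k ⊆ insert u H.graph.support := by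
  induction k with
  | zero => exact Set.singleton_subset_iff.mpr (Set.mem_insert u _)
  | succ k ih =>
    rintro x (hx | ⟨-, w, -, hadj⟩)
    · exact ih hx
    · exact Or.inr hadj.mem_support_right

theorem reach_eq_singleton (hu : u ∉ H.graph.support) : H.reach u k = {u} := by
  induction k with
  | zero => rfl
  | succ k ih =>
    refine (Set.union_subset ih.le ?_).antisymm
      (Set.singleton_subset_iff.mpr (mem_reach_self (k := k + 1)))
    rintro x ⟨-, w, hw, hadj⟩
    rw [ih] at hw
    exact absurd (hw ▸ hadj.mem_support_left) hu

end Reach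

section Clustering

variable (H : MarkedGraph ℕ) (D : ℕ)

/-- The identifier of the cluster of `u`: the smallest node within reach of `u`. -/
noncomputable def leader (u : ℕ) : ℕ := sInf (H.reach u D)

/-- The node has a neighbour in another cluster. -/
def IsBoundary (u : ℕ) : Prop := ∃ w, H.graph.Adj u w ∧ H.leader D w ≠ H.leader D u

/-- The cluster responsible for storing the certificate of `u`: the first of the clusters that meet
the closed neighbourhood of `u`. -/
noncomputable def home (u : ℕ) : ℕ := sInf (H.leader D '' insert u (H.graph.neighborSet u))

/-- The nodes whose certificates are stored in the cluster `z`. -/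
def stored (z : ℕ) : Set ℕ := {u | H.IsBoundary D u ∧ H.home D u = z}

/-- The unmarked nodes of the cluster `z`, which provide the storage of the cluster. -/
def cell (z : ℕ) : Set ℕ := {b | b ∉ H.marks ∧ H.leader D b = z}

/-- Every cluster has room for `t` pieces of each certificate that it has to store. -/
def HasCapacity (t : ℕ) : Prop := ∀ z, (H.stored D z).encard * t ≤ (H.cell D z).encard

variable {H D} {u w z : ℕ}

theorem leader_mem_reach : H.leader D u ∈ H.reach u D := Nat.sInf_mem ⟨u, mem_reach_self⟩

theorem leader_mem_closedBall : H.leader D u ∈ closedBall H.graph u D :=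
  reach_subset_closedBall leader_mem_reach

theorem leader_mem_support (hu : u ∈ H.graph.support) : H.leader D u ∈ H.graph.support :=
  closedBall_subset_support hu leader_mem_closedBall

theorem leader_eq_self (hu : u ∉ H.graph.support) : H.leader D u = u :=
  Set.mem_singleton_iff.mp (reach_eq_singleton hu ▸ leader_mem_reach)

theorem home_le_leader (hw : w ∈ insert u (H.graph.neighborSet u)) :
    H.home D u ≤ H.leader D w :=
  Nat.sInf_le ⟨w, hw, rfl⟩

theorem exists_home_eq_leader (H : MarkedGraph ℕ) (D u : ℕ) :
    ∃ w ∈ insert u (H.graph.neighborSet u), H.leader D w = H.home D u :=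
  Nat.sInf_mem ((Set.insert_nonempty u _).image _)

theorem home_mem_closedBall : H.home D u ∈ closedBall H.graph u (D + 1) := by
  obtain ⟨w, rfl | hw, hhome⟩ := exists_home_eq_leader H D u
  · exact hhome ▸ closedBall_mono D.le_succ leader_mem_closedBall
  · rw [← hhome, add_comm]
    exact mem_closedBall_add (mem_closedBall_one_of_adj hw) leader_mem_closedBall

theorem home_mem_support (hu : u ∈ H.graph.support) : H.home D u ∈ H.graph.support :=
  closedBall_subset_support hu home_mem_closedBall

theorem cell_subset_closedBall : H.cell D z ⊆ closedBall H.graph z D := by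
  rintro b ⟨-, rfl⟩
  exact mem_closedBall_comm.mp leader_mem_closedBall

theorem stored_subset_closedBall : H.stored D z ⊆ closedBall H.graph z (D + 1) := by
  rintro u ⟨-, rfl⟩
  exact mem_closedBall_comm.mp home_mem_closedBall

theorem IsBoundary.mem_support (h : H.IsBoundary D u) : u ∈ H.graph.support := by
  obtain ⟨_, hadj, _⟩ := h
  exact hadj.mem_support_left

theorem stored_subset_support : H.stored D z ⊆ H.graph.support := fun _ hu => hu.1.mem_support

end Clustering

end MarkedGraph

theorem two_mul_pow_le_succ_pow {t : ℕ} (ht : 1 ≤ t) : 2 * t ^ t ≤ (t + 1) ^ t := by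
  have bernoulli : (2 : ℚ) ≤ (1 + 1 / t) ^ t := by
    have h := one_add_mul_le_pow (a := (1 / t : ℚ))
      ((by norm_num : (-2 : ℚ) ≤ 0).trans (by positivity)) t
    rwa [mul_one_div_cancel (by positivity), one_add_one_eq_two] at h
  have h : (2 : ℚ) * t ^ t ≤ (1 + 1 / t) ^ t * t ^ t := by gcongr
  rw [← mul_pow, add_mul, one_mul, one_div_mul_cancel (by positivity)] at h
  exact_mod_cast h

theorem exists_slow_growth {b : ℕ → ℕ} {t m n : ℕ} (ht : 1 ≤ t) (h0 : 1 ≤ b 0)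
    (hb : ∀ j, b j ≤ n) (hn : n < 2 ^ m) : ∃ j < t * m, t * b (j + 1) ≤ (t + 1) * b j := by
  by_contra! hfast
  have hgrow : ∀ j ≤ t * m, (t + 1) ^ j ≤ t ^ j * b j := by
    intro j
    induction j with
    | zero => simpa using h0
    | succ j ih =>
      intro hj
      calc (t + 1) ^ (j + 1) = (t + 1) * (t + 1) ^ j := by ring
        _ ≤ (t + 1) * (t ^ j * b j) := Nat.mul_le_mul_left _ (ih (by lia))
        _ = t ^ j * ((t + 1) * b j) := by ring
        _ ≤ t ^ j * (t * b (j + 1)) := Nat.mul_le_mul_left _ (hfast j (by lia)).le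
        _ = t ^ (j + 1) * b (j + 1) := by ring
  have hlarge : t ^ (t * m) * 2 ^ m ≤ t ^ (t * m) * b (t * m) :=
    calc t ^ (t * m) * 2 ^ m = (2 * t ^ t) ^ m := by rw [mul_pow, ← pow_mul, mul_comm]
      _ ≤ ((t + 1) ^ t) ^ m := Nat.pow_le_pow_left (two_mul_pow_le_succ_pow ht) m
      _ = (t + 1) ^ (t * m) := (pow_mul _ _ _).symm
      _ ≤ t ^ (t * m) * b (t * m) := hgrow _ le_rfl
  exact hn.not_ge ((Nat.le_of_mul_le_mul_left hlarge (by positivity)).trans (hb _))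

/-- The graph in which all nodes of `S` are isolated. -/
def isolate {V : Type*} (G : SimpleGraph V) (S : Set V) : SimpleGraph V where
  Adj u w := G.Adj u w ∧ u ∉ S ∧ w ∉ S
  symm := ⟨fun _ _ h => ⟨h.1.symm, h.2.2, h.2.1⟩⟩
  loopless := ⟨fun _ h => h.1.ne rfl⟩

theorem support_isolate_subset {V : Type*} {G : SimpleGraph V} {S : Set V} :
    (isolate G S).support ⊆ G.support \ S := by
  rintro u ⟨w, h⟩
  exact ⟨h.1.mem_support_left, h.2.1⟩

namespace MarkedGraph

/-- The marking which separates the ball of radius `s` around `z` from the rest of the graph by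
its outermost layer, and is given by `M` on the rest. -/
def carve (G : SimpleGraph ℕ) (M : Set ℕ) (z s : ℕ) : MarkedGraph ℕ :=
  ⟨G, closedBall G z (s + 1) \ closedBall G z s ∪ M⟩

/-- The part of the marked graph `carve G M z s` that lies outside the carved ball. -/
def remainder (G : SimpleGraph ℕ) (M : Set ℕ) (z s : ℕ) : MarkedGraph ℕ :=
  ⟨isolate G (closedBall G z (s + 1)), M⟩

section Carve

variable {G : SimpleGraph ℕ} {M : Set ℕ} {z s k D t u w c : ℕ}

theorem reach_carve_eq_reach_remainder (hu : u ∉ closedBall G z (s + 1)) :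
    (carve G M z s).reach u k = (remainder G M z s).reach u k := by
  induction k with
  | zero => rfl
  | succ k ih =>
    rw [reach, reach, ih]
    congr 1
    ext x
    refine ⟨?_, fun ⟨hx, w, hw, hadj⟩ => ⟨?_, w, hw, hadj.1⟩⟩
    · rintro ⟨hx, w, hw, hadj⟩
      have hw' : w ∉ closedBall G z (s + 1) :=
        (reach_subset_insert_support hw).elim (fun h => h ▸ hu)
          fun h => (support_isolate_subset h).2
      have hx' : x ∉ closedBall G z (s + 1) := fun hxB =>
        hx (Or.inl ⟨hxB, fun hxs => hw' (mem_closedBall_succ.mpr ⟨x, hxs, Or.inr hadj.symm⟩)⟩)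
      exact ⟨fun hxM => hx (Or.inr hxM), w, hw, hadj, hw', hx'⟩
    · exact not_or.mpr ⟨fun h => hadj.2.2 h.1, hx⟩

theorem leader_carve_eq_leader_remainder (hu : u ∉ closedBall G z (s + 1)) :
    (carve G M z s).leader D u = (remainder G M z s).leader D u := by
  rw [leader, leader, reach_carve_eq_reach_remainder hu]

theorem center_mem_reach_carve (hM : Disjoint M (closedBall G z (s + 1))) (hk : k ≤ s + 1)
    (hu : u ∈ closedBall G z k) : z ∈ (carve G M z s).reach u k := by
  induction k generalizing u with
  | zero => exact (Set.ext_iff.mp closedBall_zero u).mp hu ▸ mem_reach_self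
  | succ k ih =>
    obtain ⟨w, hw, rfl | hadj⟩ := mem_closedBall_succ.mp hu
    · exact reach_mono k.le_succ (ih (by lia) hw)
    · refine reach_subset_reach_succ_of_adj hadj.symm ?_ (ih (by lia) hw)
      exact not_or.mpr ⟨fun h => h.2 (closedBall_mono (by lia) hw),
        fun h => hM.notMem_of_mem_left h (closedBall_mono (by lia) hw)⟩

theorem leader_carve_eq_center (hz : IsLeast G.support z)
    (hM : Disjoint M (closedBall G z (s + 1))) (hD : s + 1 ≤ D)
    (hu : u ∈ closedBall G z (s + 1)) : (carve G M z s).leader D u = z :=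
  (Nat.sInf_le (reach_mono hD (center_mem_reach_carve hM le_rfl hu))).antisymm
    (hz.2 (leader_mem_support (H := carve G M z s) (closedBall_subset_support hz.1 hu)))

theorem leader_remainder_notMem_closedBall (hu : u ∉ closedBall G z (s + 1)) :
    (remainder G M z s).leader D u ∉ closedBall G z (s + 1) :=
  (reach_subset_insert_support leader_mem_reach).elim (fun h => h.symm ▸ hu)
    fun h => (support_isolate_subset h).2

theorem mem_closedBall_of_leader_carve_eq_center (hu : (carve G M z s).leader D u = z) :
    u ∈ closedBall G z (s + 1) := by
  by_contra hu'
  rw [leader_carve_eq_leader_remainder hu'] at hu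
  have hz := leader_remainder_notMem_closedBall (M := M) (D := D) hu'
  exact hz (by rw [hu]; exact mem_closedBall_self)

theorem stored_carve_center_subset (hz : IsLeast G.support z)
    (hM : Disjoint M (closedBall G z (s + 1))) (hD : s + 1 ≤ D) :
    (carve G M z s).stored D z ⊆ closedBall G z (s + 2) \ closedBall G z s := by
  rintro u ⟨⟨w, hadj, hne⟩, hhome⟩
  constructor
  · obtain ⟨y, hy, hleader⟩ := exists_home_eq_leader (carve G M z s) D u
    exact mem_closedBall_succ.mpr
      ⟨y, mem_closedBall_of_leader_carve_eq_center (hleader.trans hhome), hy.imp id .symm⟩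
  · intro hu
    refine hne ?_
    rw [leader_carve_eq_center hz hM hD (closedBall_mono s.le_succ hu),
      leader_carve_eq_center hz hM hD (mem_closedBall_succ.mpr ⟨u, hu, Or.inr hadj⟩)]

theorem closedBall_subset_cell_carve_center (hz : IsLeast G.support z)
    (hM : Disjoint M (closedBall G z (s + 1))) (hD : s + 1 ≤ D) :
    closedBall G z s ⊆ (carve G M z s).cell D z := fun _ hu =>
  have hu' := closedBall_mono s.le_succ hu
  ⟨not_or.mpr ⟨fun h => h.2 hu, fun h => hM.notMem_of_mem_left h hu'⟩,
    leader_carve_eq_center hz hM hD hu'⟩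

theorem encard_stored_carve_center_mul_le (hz : IsLeast G.support z) (hfin : G.support.Finite)
    (hM : Disjoint M (closedBall G z (s + 1))) (hD : s + 1 ≤ D)
    (hs : t * (closedBall G z (s + 2)).ncard ≤ (t + 1) * (closedBall G z s).ncard) :
    ((carve G M z s).stored D z).encard * t ≤ ((carve G M z s).cell D z).encard := by
  have hfin' (k : ℕ) : (closedBall G z k).Finite := hfin.subset (closedBall_subset_support hz.1)
  have hsplit := Set.ncard_sdiff_add_ncard_of_subset
    (closedBall_mono (G := G) (v := z) (Nat.le_add_right s 2)) (hfin' _)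
  calc ((carve G M z s).stored D z).encard * t
      ≤ (closedBall G z (s + 2) \ closedBall G z s).encard * t := by
        gcongr
        exact stored_carve_center_subset hz hM hD
    _ ≤ (closedBall G z s).encard := by
        rw [← (hfin' s).cast_ncard_eq, ← (hfin' _).sdiff.cast_ncard_eq]
        norm_cast
        rw [← hsplit] at hs
        linarith
    _ ≤ ((carve G M z s).cell D z).encard :=
        Set.encard_le_encard (closedBall_subset_cell_carve_center hz hM hD)

theorem notMem_closedBall_of_home_carve_ne (hz : IsLeast G.support z)
    (hM : Disjoint M (closedBall G z (s + 1))) (hD : s + 1 ≤ D) (hu : u ∈ G.support)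
    (hne : (carve G M z s).home D u ≠ z) (hw : w ∈ insert u (G.neighborSet u)) :
    w ∉ closedBall G z (s + 1) := fun hwB =>
  hne (((home_le_leader (H := carve G M z s) hw).trans_eq
    (leader_carve_eq_center hz hM hD hwB)).antisymm
      (hz.2 (home_mem_support (H := carve G M z s) hu)))

theorem stored_carve_subset_stored_remainder (hz : IsLeast G.support z)
    (hM : Disjoint M (closedBall G z (s + 1))) (hD : s + 1 ≤ D) (hc : c ≠ z) :
    (carve G M z s).stored D c ⊆ (remainder G M z s).stored D c := by
  rintro u ⟨⟨w, hadj, hne⟩, rfl⟩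
  have hout {y : ℕ} (hy : y ∈ insert u (G.neighborSet u)) : y ∉ closedBall G z (s + 1) :=
    notMem_closedBall_of_home_carve_ne hz hM hD hadj.mem_support_left hc hy
  have hu : u ∉ closedBall G z (s + 1) := hout (Set.mem_insert u _)
  have hnbr : (remainder G M z s).graph.neighborSet u = G.neighborSet u :=
    Set.ext fun y => ⟨fun h => h.1, fun h => ⟨h, hu, hout (Or.inr h)⟩⟩
  refine ⟨⟨w, ⟨hadj, hu, hout (Or.inr hadj)⟩, ?_⟩, ?_⟩
  · rwa [← leader_carve_eq_leader_remainder hu,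
      ← leader_carve_eq_leader_remainder (hout (Or.inr hadj))]
  · rw [home, home, hnbr]
    exact congrArg sInf <| Set.image_congr fun y hy =>
      (leader_carve_eq_leader_remainder (hout hy)).symm

theorem cell_remainder_subset_cell_carve (hc : c ∉ closedBall G z (s + 1)) :
    (remainder G M z s).cell D c ⊆ (carve G M z s).cell D c := by
  rintro b ⟨hbM, rfl⟩
  have hb : b ∉ closedBall G z (s + 1) := fun hb => hc <| by
    rwa [leader_eq_self (H := remainder G M z s) fun h => (support_isolate_subset h).2 hb]
  exact ⟨not_or.mpr ⟨fun h => hb h.1, hbM⟩, leader_carve_eq_leader_remainder hb⟩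

theorem HasCapacity.carve (hz : IsLeast G.support z) (hfin : G.support.Finite)
    (hM : Disjoint M (closedBall G z (s + 1))) (hD : s + 1 ≤ D)
    (hs : t * (closedBall G z (s + 2)).ncard ≤ (t + 1) * (closedBall G z s).ncard)
    (h : (remainder G M z s).HasCapacity D t) : (carve G M z s).HasCapacity D t := by
  intro c
  obtain rfl | hc := eq_or_ne c z
  · exact encard_stored_carve_center_mul_le hz hfin hM hD hs
  have hstored := stored_carve_subset_stored_remainder hz hM hD hc
  obtain hempty | ⟨u, hu⟩ := ((MarkedGraph.carve G M z s).stored D c).eq_empty_or_nonempty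
  · simp [hempty]
  · have hc' : c ∉ closedBall G z (s + 1) := by
      obtain ⟨hbdry, rfl⟩ := hstored hu
      exact (support_isolate_subset (home_mem_support hbdry.mem_support)).2
    calc ((MarkedGraph.carve G M z s).stored D c).encard * t
        ≤ ((remainder G M z s).stored D c).encard * t := by gcongr
      _ ≤ ((remainder G M z s).cell D c).encard := h c
      _ ≤ ((MarkedGraph.carve G M z s).cell D c).encard :=
          Set.encard_le_encard (cell_remainder_subset_cell_carve hc')

end Carve

theorem exists_hasCapacity {t m D : ℕ} (ht : 1 ≤ t) (hD : 2 * (t * m) ≤ D) (G : SimpleGraph ℕ)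
    (hfin : G.support.Finite) (hcard : G.support.ncard < 2 ^ m) :
    ∃ M ⊆ G.support, HasCapacity ⟨G, M⟩ D t := by
  induction hn : G.support.ncard using Nat.strong_induction_on generalizing G with
  | _ n ih =>
  obtain hempty | hne := G.support.eq_empty_or_nonempty
  · refine ⟨∅, Set.empty_subset _, fun c => ?_⟩
    have : stored ⟨G, ∅⟩ D c = ∅ := Set.subset_empty_iff.mp (stored_subset_support.trans hempty.le)
    simp [this]
  have hz : IsLeast G.support (sInf G.support) := ⟨Nat.sInf_mem hne, fun _ => Nat.sInf_le⟩
  set z := sInf G.support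
  have hball (k : ℕ) : closedBall G z k ⊆ G.support := closedBall_subset_support hz.1
  obtain ⟨j, hj, hslow⟩ := exists_slow_growth (b := fun j => (closedBall G z (2 * j)).ncard) ht
    (by simp [closedBall_zero]) (fun j => Set.ncard_le_ncard (hball _) hfin) hcard
  set G' := isolate G (closedBall G z (2 * j + 1))
  have hsub : G'.support ⊆ G.support := support_isolate_subset.trans Set.sdiff_subset
  have hlt : G'.support.ncard < n := hn ▸ Set.ncard_lt_ncard
    ⟨hsub, fun h => (support_isolate_subset (h hz.1)).2 mem_closedBall_self⟩ hfin
  obtain ⟨M, hM, hcap⟩ := ih _ hlt G' (hfin.subset hsub) ((hlt.trans_eq hn.symm).trans hcard) rfl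
  have hdisj : Disjoint M (closedBall G z (2 * j + 1)) :=
    Set.disjoint_left.mpr fun x hx => (support_isolate_subset (hM hx)).2
  exact ⟨_, Set.union_subset (Set.sdiff_subset.trans (hball _)) (hM.trans hsub),
    HasCapacity.carve hz hfin hdisj (by lia) hslow hcap⟩

end MarkedGraph

section Storage

variable {α β γ : Type*}

/-- A choice of `t` places in `B` for each element of `A`, injective if there is enough room. It is
a function of `A` and `B` alone, so that readers and writers agree on it. -/
noncomputable def slot [Nonempty β] (t : ℕ) (A : Set α) (B : Set β) : α × ℕ → β :=
  Classical.epsilon fun f => Set.InjOn f (A ×ˢ Set.Iio t) ∧ Set.MapsTo f (A ×ˢ Set.Iio t) B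

open Classical in
/-- The concatenation of the strings stored for `a`. Places outside `B` are not read, although
`slot` takes such values if `B` is too small. -/
noncomputable def retrieve [Nonempty β] (t : ℕ) (A : Set α) (B : Set β) (store : β → List γ)
    (a : α) : List γ :=
  (List.range t).flatMap fun i => if slot t A B (a, i) ∈ B then store (slot t A B (a, i)) else []

theorem retrieve_congr [Nonempty β] {t : ℕ} {A : Set α} {B : Set β} {store store' : β → List γ}
    (h : Set.EqOn store store' B) : retrieve t A B store = retrieve t A B store' := by
  funext a
  refine List.flatMap_congr fun i _ => ?_
  split_ifs with hi
  exacts [h hi, rfl]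

theorem slot_spec [Nonempty β] {t : ℕ} {A : Set α} {B : Set β} (hA : A.Finite)
    (h : A.encard * t ≤ B.encard) :
    Set.InjOn (slot t A B) (A ×ˢ Set.Iio t) ∧ Set.MapsTo (slot t A B) (A ×ˢ Set.Iio t) B := by
  have hcard : (A ×ˢ Set.Iio t).encard ≤ B.encard := by
    rwa [Set.encard_prod, ← Set.coe_fintypeCard (Set.Iio t), Fintype.card_Iio, Nat.card_Iio]
  obtain ⟨f, hf, hinj⟩ := (hA.prod (Set.finite_Iio t)).exists_injOn_of_encard_le hcard
  exact Classical.epsilon_spec (p := fun f : α × ℕ → β =>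
    Set.InjOn f (A ×ˢ Set.Iio t) ∧ Set.MapsTo f (A ×ˢ Set.Iio t) B) ⟨f, hinj, hf⟩

theorem flatMap_range_take_drop (l : List γ) (q k : ℕ) :
    (List.range k).flatMap (fun i => (l.drop (i * q)).take q) = l.take (k * q) := by
  induction k with
  | zero => simp
  | succ k ih => rw [List.range_succ, List.flatMap_append, ih, Nat.succ_mul, List.take_add]; simp

theorem exists_retrieve_eq [Nonempty α] [Nonempty β] {t q : ℕ} {A : Set α} {B : Set β}
    (hA : A.Finite) (h : A.encard * t ≤ B.encard) {cert : α → List γ}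
    (hcert : ∀ a ∈ A, (cert a).length ≤ t * q) :
    ∃ store : β → List γ, (∀ b, (store b).length ≤ q) ∧
      ∀ a ∈ A, retrieve t A B store a = cert a := by
  obtain ⟨hinj, hmaps⟩ := slot_spec hA h
  let chunk (x : α × ℕ) : List γ := ((cert x.1).drop (x.2 * q)).take q
  let owner : β → α × ℕ := Function.invFunOn (slot t A B) (A ×ˢ Set.Iio t)
  refine ⟨fun b => chunk (owner b), fun b => List.length_take_le _ _, fun a ha => ?_⟩
  calc retrieve t A B (fun b => chunk (owner b)) a
      = (List.range t).flatMap fun i => chunk (a, i) := by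
        refine List.flatMap_congr fun i hi => ?_
        have hai : (a, i) ∈ A ×ˢ Set.Iio t := ⟨ha, List.mem_range.mp hi⟩
        rw [if_pos (hmaps hai)]
        exact congrArg chunk (hinj.leftInvOn_invFunOn hai)
    _ = (cert a).take (t * q) := flatMap_range_take_drop (cert a) q t
    _ = cert a := List.take_of_length_le (hcert a ha)

end Storage

/-- A graph on the natural numbers with inputs and labels. Comparing configurations on different
sets of nodes is easier after extending them to networks on `ℕ`. -/
structure Network where
  graph : SimpleGraph ℕ
  input : ℕ → BitString
  label : ℕ → BitString

namespace Network

/-- The graph of a network, where the first bits of the labels are the marks. -/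
def marked (N : Network) : MarkedGraph ℕ := ⟨N.graph, {u | (N.label u).head? = some true}⟩

/-- The part of the label of `u` that stores pieces of certificates. -/
def payload (N : Network) (u : ℕ) : BitString := (N.label u).tail

/-- The certificate of `u` as read off from the labels in the home cluster of `u`. -/
noncomputable def decode (N : Network) (D t u : ℕ) : BitString :=
  retrieve t (N.marked.stored D (N.marked.home D u)) (N.marked.cell D (N.marked.home D u))
    N.payload u

/-- The labels encode the certificates of all nodes with neighbours in other clusters. -/
def Encodes (N : Network) (D t : ℕ) (cert : ℕ → BitString) : Prop :=
  ∀ u, N.marked.IsBoundary D u → N.decode D t u = cert u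

/-- The two networks coincide up to distance `R` from `v`, including the edges that leave this
ball. -/
def Agree (N N' : Network) (v R : ℕ) : Prop :=
  ∀ x ∈ closedBall N.graph v R, (∀ y, N.graph.Adj x y ↔ N'.graph.Adj x y) ∧
    N.input x = N'.input x ∧ N.label x = N'.label x

namespace Agree

variable {N N' : Network} {u v z k R R' D t : ℕ}

theorem mono (h : N.Agree N' v R) (hR : R' ≤ R) : N.Agree N' v R' := fun x hx =>
  h x (closedBall_mono hR hx)

theorem recenter (h : N.Agree N' v R) (hu : u ∈ closedBall N.graph v k) (hR : k + R' ≤ R) :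
    N.Agree N' u R' := fun x hx => h x (closedBall_mono hR (mem_closedBall_add hu hx))

theorem closedBall_eq (h : N.Agree N' v R) (hk : k ≤ R + 1) :
    closedBall N.graph v k = closedBall N'.graph v k := by
  induction k with
  | zero => rw [closedBall_zero, closedBall_zero]
  | succ k ih =>
    ext x
    rw [mem_closedBall_succ, mem_closedBall_succ, ← ih (by lia)]
    refine exists_congr fun w => and_congr_right fun hw => or_congr_right ?_
    exact (h w (closedBall_mono (by lia) hw)).1 x

theorem symm (h : N.Agree N' v R) : N'.Agree N v R := fun x hx =>
  have hx := h x (h.closedBall_eq R.le_succ ▸ hx)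
  ⟨fun y => (hx.1 y).symm, hx.2.1.symm, hx.2.2.symm⟩

theorem neighborSet_eq (h : N.Agree N' v R) : N.graph.neighborSet v = N'.graph.neighborSet v :=
  Set.ext (h v mem_closedBall_self).1

theorem mem_marks_iff (h : N.Agree N' v R) : v ∈ N.marked.marks ↔ v ∈ N'.marked.marks := by
  simp only [marked, Set.mem_ofPred_eq, (h v mem_closedBall_self).2.2]

theorem reach_subset (h : N.Agree N' v R) (hk : k ≤ R) :
    N.marked.reach v k ⊆ N'.marked.reach v k := by
  induction k with
  | zero => exact subset_rfl
  | succ k ih =>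
    rintro x (hx | ⟨hxM, w, hw, hadj⟩)
    · exact Or.inl (ih (by lia) hx)
    · have hwB := MarkedGraph.reach_subset_closedBall hw
      have hx : N.Agree N' x 0 :=
        h.recenter (mem_closedBall_succ.mpr ⟨w, hwB, Or.inr hadj⟩) hk
      exact Or.inr ⟨mt hx.mem_marks_iff.mpr hxM, w, ih (by lia) hw,
        ((h w (closedBall_mono (by lia) hwB)).1 x).mp hadj⟩

theorem reach_eq (h : N.Agree N' v R) (hk : k ≤ R) :
    N.marked.reach v k = N'.marked.reach v k :=
  (h.reach_subset hk).antisymm (h.symm.reach_subset hk)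

theorem leader_eq (h : N.Agree N' v D) : N.marked.leader D v = N'.marked.leader D v := by
  rw [MarkedGraph.leader, MarkedGraph.leader, h.reach_eq le_rfl]

theorem leader_eq_of_adj (h : N.Agree N' v (D + 1)) (hu : N.graph.Adj v u) :
    N.marked.leader D u = N'.marked.leader D u :=
  (h.recenter (mem_closedBall_one_of_adj hu) (by lia)).leader_eq

theorem isBoundary (h : N.Agree N' v (D + 1)) (hv : N.marked.IsBoundary D v) :
    N'.marked.IsBoundary D v := by
  obtain ⟨w, hadj, hne⟩ := hv
  refine ⟨w, ((h v mem_closedBall_self).1 w).mp hadj, ?_⟩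
  rwa [← h.leader_eq_of_adj hadj, ← (h.mono D.le_succ).leader_eq]

theorem home_eq (h : N.Agree N' v (D + 1)) : N.marked.home D v = N'.marked.home D v := by
  have himage : N.marked.leader D '' insert v (N.graph.neighborSet v) =
      N'.marked.leader D '' insert v (N'.graph.neighborSet v) := by
    rw [← h.neighborSet_eq]
    refine Set.image_congr ?_
    rintro w (rfl | hw)
    exacts [(h.mono D.le_succ).leader_eq, h.leader_eq_of_adj hw]
  exact congrArg sInf himage

theorem cell_subset (h : N.Agree N' z (2 * D)) : N.marked.cell D z ⊆ N'.marked.cell D z :=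
  fun b hb => by
    have hb' := h.recenter (R' := D) (MarkedGraph.cell_subset_closedBall hb) (by lia)
    exact ⟨fun hm => hb.1 (hb'.mem_marks_iff.mpr hm), hb'.leader_eq ▸ hb.2⟩

theorem cell_eq (h : N.Agree N' z (2 * D)) : N.marked.cell D z = N'.marked.cell D z :=
  h.cell_subset.antisymm h.symm.cell_subset

theorem stored_subset (h : N.Agree N' z (2 * D + 2)) :
    N.marked.stored D z ⊆ N'.marked.stored D z := fun u hu => by
  have hu' := h.recenter (R' := D + 1) (MarkedGraph.stored_subset_closedBall hu) (by lia)
  exact ⟨hu'.isBoundary hu.1, hu'.home_eq ▸ hu.2⟩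

theorem stored_eq (h : N.Agree N' z (2 * D + 2)) : N.marked.stored D z = N'.marked.stored D z :=
  h.stored_subset.antisymm h.symm.stored_subset

theorem decode_eq (h : N.Agree N' u (3 * D + 3)) : N.decode D t u = N'.decode D t u := by
  have hhome : N.Agree N' (N.marked.home D u) (2 * D + 2) :=
    h.recenter (MarkedGraph.home_mem_closedBall (H := N.marked)) (by lia)
  have hpayload : Set.EqOn N.payload N'.payload (N.marked.cell D (N.marked.home D u)) :=
    fun b hb => congrArg List.tail
      (hhome b (closedBall_mono (i := D) (by lia) (MarkedGraph.cell_subset_closedBall hb))).2.2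
  rw [decode, decode, retrieve_congr hpayload, hhome.stored_eq,
    (hhome.mono (Nat.le_add_right _ 2)).cell_eq, Agree.home_eq (h.mono (by lia))]

end Agree

open Classical in
/-- The view of the node `v` in a network, with the number of nodes set to `n`. -/
noncomputable def view (N : Network) (n r v : ℕ) : View where
  size := n
  center := v
  nodes := closedBall N.graph v r
  adj a b := a ∈ closedBall N.graph v r ∧ b ∈ closedBall N.graph v r ∧ N.graph.Adj a b
  input a := if a ∈ closedBall N.graph v r then some (N.input a) else none
  label a := if a ∈ closedBall N.graph v r then some (N.label a) else none

variable {N N' : Network} {n n' r v x R : ℕ}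

theorem Agree.view_eq (h : N.Agree N' v r) : N.view n r v = N'.view n r v := by
  unfold view
  rw [← h.closedBall_eq r.le_succ]
  congr 1
  · ext a b
    exact and_congr_right fun ha => and_congr_right fun _ => (h a ha).1 b
  · funext a
    split_ifs with ha
    exacts [congrArg some (h a ha).2.1, rfl]
  · funext a
    split_ifs with ha
    exacts [congrArg some (h a ha).2.2, rfl]

theorem input_label_eq_of_view_eq (h : N.view n r v = N'.view n' r v)
    (hx : x ∈ closedBall N.graph v r) : N.input x = N'.input x ∧ N.label x = N'.label x := by
  have hball : closedBall N.graph v r = closedBall N'.graph v r := congrArg View.nodes h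
  have hx' : x ∈ closedBall N'.graph v r := hball ▸ hx
  have hinput := congrFun (congrArg View.input h) x
  have hlabel := congrFun (congrArg View.label h) x
  simp only [view, if_pos hx, if_pos hx', Option.some.injEq] at hinput hlabel
  exact ⟨hinput, hlabel⟩

theorem adj_iff_of_view_eq (h : N.view n r v = N'.view n' r v)
    (hx : x ∈ closedBall N.graph v r) {y : ℕ} (hy : y ∈ closedBall N.graph v r) :
    N.graph.Adj x y ↔ N'.graph.Adj x y := by
  have hball : closedBall N.graph v r = closedBall N'.graph v r := congrArg View.nodes h
  have hadj := congrFun (congrFun (congrArg View.adj h) x) y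
  simpa only [view, ← hball, hx, hy, true_and, eq_iff_iff] using hadj

theorem closedBall_subset_of_view_eq (h : N.view n r v = N'.view n' r v) (hR : R ≤ r) :
    closedBall N.graph v R ⊆ closedBall N'.graph v R := by
  induction R with
  | zero => rw [closedBall_zero, closedBall_zero]
  | succ R ih =>
    intro x hx
    obtain ⟨w, hw, hwx⟩ := mem_closedBall_succ.mp hx
    exact mem_closedBall_succ.mpr ⟨w, ih (by lia) hw, hwx.imp_right
      (adj_iff_of_view_eq h (closedBall_mono (by lia) hw) (closedBall_mono hR hx)).mp⟩

theorem agree_of_view_eq (h : N.view n r v = N'.view n' r v) (hR : R + 1 ≤ r) :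
    N.Agree N' v R := fun x hx => by
  have hxr := closedBall_mono (R.le_succ.trans hR) hx
  refine ⟨fun y => ⟨fun hadj => ?_, fun hadj => ?_⟩, input_label_eq_of_view_eq h hxr⟩
  · exact (adj_iff_of_view_eq h hxr
      (closedBall_mono hR (mem_closedBall_succ.mpr ⟨x, hx, Or.inr hadj⟩))).mp hadj
  · have hx' := closedBall_subset_of_view_eq h (R.le_succ.trans hR) hx
    exact (adj_iff_of_view_eq h.symm (closedBall_mono (R.le_succ.trans hR) hx')
      (closedBall_mono hR (mem_closedBall_succ.mpr ⟨x, hx', Or.inr hadj⟩))).mp hadj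

theorem agree_of_view_eq_of_graph_eq_bot (hN : N.graph = ⊥) (hN' : N'.graph = ⊥)
    (h : N.view n r v = N'.view n' r v) : N.Agree N' v R := fun x hx => by
  obtain rfl : v = x := by
    by_contra hne
    rw [hN, mem_closedBall, SimpleGraph.edist_bot_of_ne hne] at hx
    exact ENat.natCast_ne_top _ (top_le_iff.mp hx)
  exact ⟨fun y => by rw [hN, hN'], input_label_eq_of_view_eq h mem_closedBall_self⟩

end Network

namespace Config

/-- The graph of a configuration, with all other natural numbers as isolated nodes. -/
def natGraph (C : Config) : SimpleGraph ℕ := C.net.graph.map (Function.Embedding.subtype _)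

/-- A function on the nodes, extended by the empty string. -/
def extend (C : Config) (l : C.Node → BitString) (a : ℕ) : BitString :=
  if h : a ∈ C.net.verts then l ⟨a, h⟩ else []

/-- A labelled configuration as a network on the natural numbers. -/
def toNetwork (C : Config) (l : C.Node → BitString) : Network where
  graph := C.natGraph
  input := C.extend C.input
  label := C.extend l

variable {C C' : Config} {l : C.Node → BitString} {l' : C'.Node → BitString} {v : C.Node}
  {v' : C'.Node} {r R k : ℕ}

theorem extend_coe (l : C.Node → BitString) (v : C.Node) : C.extend l v = l v := dif_pos v.2

theorem support_natGraph_subset : C.natGraph.support ⊆ C.net.verts := by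
  rintro _ ⟨_, -, a, b, -, rfl, -⟩
  exact a.2

theorem closedBall_natGraph :
    closedBall C.natGraph v k = Subtype.val '' C.ball k v :=
  closedBall_map (Function.Embedding.subtype _)

theorem closedBall_natGraph_subset : closedBall C.natGraph v k ⊆ C.net.verts := by
  rw [closedBall_natGraph]
  rintro _ ⟨x, -, rfl⟩
  exact x.2

theorem natGraph_eq_bot (h : C.net.size < 2) : C.natGraph = ⊥ := by
  rw [SimpleGraph.eq_bot_iff_forall_not_adj]
  rintro _ _ ⟨-, a, b, hadj, -, -⟩
  exact hadj.ne (Subtype.ext (Finset.card_le_one.mp (Nat.lt_succ_iff.mp h) a a.2 b b.2))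

open Classical in
theorem dite_ball_eq (f : C.Node → BitString) (a : ℕ) :
    (if h : ∃ x ∈ C.ball r v, (x : ℕ) = a then some (f h.choose) else none) =
      if a ∈ closedBall C.natGraph v r then some (C.extend f a) else none := by
  rw [closedBall_natGraph]
  by_cases h : ∃ x ∈ C.ball r v, (x : ℕ) = a
  · have ha : a ∈ Subtype.val '' C.ball r v := h
    rw [dif_pos h, if_pos ha, ← extend_coe f, h.choose_spec.2]
  · have ha : a ∉ Subtype.val '' C.ball r v := h
    rw [dif_neg h, if_neg ha]

theorem view_eq_toNetwork_view : C.view l r v = (C.toNetwork l).view C.net.size r v := by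
  unfold view Network.view
  congr 1
  · exact closedBall_natGraph.symm
  · ext a b
    simp only [toNetwork]
    rw [closedBall_natGraph]
    constructor
    · rintro ⟨x, hx, y, hy, rfl, rfl, hxy⟩
      exact ⟨⟨x, hx, rfl⟩, ⟨y, hy, rfl⟩, SimpleGraph.map_adj_apply.mpr hxy⟩
    · rintro ⟨⟨x, hx, rfl⟩, ⟨y, hy, rfl⟩, hxy⟩
      exact ⟨x, hx, y, hy, rfl, rfl, SimpleGraph.map_adj_apply.mp hxy⟩
  · exact funext (dite_ball_eq C.input)
  · exact funext (dite_ball_eq l)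

theorem agree_of_view_eq (h : C.view l r v = C'.view l' r v')
    (hR : 2 ≤ C.net.size → R + 1 ≤ r) : (C.toNetwork l).Agree (C'.toNetwork l') v R := by
  have hsize : C.net.size = C'.net.size := congrArg View.size h
  have hcenter : (v : ℕ) = v' := congrArg View.center h
  rw [view_eq_toNetwork_view, view_eq_toNetwork_view, ← hcenter] at h
  obtain hn | hn := lt_or_ge C.net.size 2
  · exact Network.agree_of_view_eq_of_graph_eq_bot (natGraph_eq_bot hn)
      (natGraph_eq_bot (hsize ▸ hn)) h
  · exact Network.agree_of_view_eq h (hR hn)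

theorem exists_encodes {t m q D : ℕ} (C : Config) (cert : ℕ → BitString) (ht : 1 ≤ t)
    (hD : 2 * (t * m) ≤ D) (hsize : C.net.size < 2 ^ m) (hcert : ∀ u, (cert u).length ≤ t * q) :
    ∃ l : C.Node → BitString, (∀ v, (l v).length ≤ q + 1) ∧ (C.toNetwork l).Encodes D t cert := by
  have hfin : C.natGraph.support.Finite := C.net.verts.finite_toSet.subset support_natGraph_subset
  have hcard : C.natGraph.support.ncard < 2 ^ m :=
    ((Set.ncard_le_ncard support_natGraph_subset C.net.verts.finite_toSet).trans_eq
      (Set.ncard_coe_finset _)).trans_lt hsize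
  obtain ⟨M, hM, hcap⟩ := MarkedGraph.exists_hasCapacity ht hD C.natGraph hfin hcard
  set H : MarkedGraph ℕ := ⟨C.natGraph, M⟩
  choose pay hpay hretrieve using fun z => exists_retrieve_eq
    (hfin.subset (H.stored_subset_support (D := D) (z := z))) (hcap z) fun u _ => hcert u
  classical
  let l (v : C.Node) : BitString := decide ((v : ℕ) ∈ M) :: pay (H.leader D v) v
  have hmarked : (C.toNetwork l).marked = H := by
    refine congrArg (MarkedGraph.mk C.natGraph) (Set.ext fun a => ?_)
    by_cases ha : a ∈ C.net.verts
    · simp [toNetwork, extend, ha, l]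
    · have haM : a ∉ M := fun h => ha (support_natGraph_subset (hM h))
      simp [toNetwork, extend, ha, haM]
  refine ⟨l, fun v => Nat.succ_le_succ (hpay _ _), fun u hu => ?_⟩
  rw [hmarked] at hu
  have hpayload : Set.EqOn (C.toNetwork l).payload (pay (H.home D u)) (H.cell D (H.home D u)) := by
    intro b hb
    have hb' : b ∈ C.net.verts := support_natGraph_subset <| closedBall_subset_support
      (H.home_mem_support hu.mem_support) (H.cell_subset_closedBall hb)
    simp [Network.payload, toNetwork, extend, hb', l, hb.2]
  rw [Network.decode, hmarked, retrieve_congr hpayload]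
  exact hretrieve _ u ⟨hu, rfl⟩

theorem encodes_nil {D t : ℕ} {cert : ℕ → BitString} (h : ∀ u, cert u = []) :
    (C.toNetwork fun _ => []).Encodes D t cert := by
  intro u _
  have hpayload : (C.toNetwork fun _ => []).payload = fun _ => [] := by
    funext b
    simp [Network.payload, toNetwork, extend]
  simp [Network.decode, retrieve, hpayload, h u]

end Config

namespace PLS

variable {𝒢 : Set NetGraph} {ℐ : Set BitString} {P : configs 𝒢 ℐ → Prop} {r : ℕ → ℕ}

theorem length_prov_le (S : PLS P r) {C : configs 𝒢 ℐ} {p : ℕ} (h : S.cost C.1.net.size ≤ p)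
    (hC : P C) (v : C.1.Node) : (S.prov C v).length ≤ p := by
  have hcost : ((S.prov C v).length : ℕ∞) ≤ S.cost C.1.net.size :=
    le_iSup_of_le C (le_iSup_of_le ⟨hC, rfl⟩ (le_iSup_of_le v le_rfl))
  exact_mod_cast hcost.trans h

/-- The certificates of the honest prover, on all natural numbers. -/
def cert (S : PLS P r) (C : configs 𝒢 ℐ) : ℕ → BitString := C.1.extend (S.prov C)

theorem length_cert_le (S : PLS P r) {C : configs 𝒢 ℐ} {p : ℕ} (h : S.cost C.1.net.size ≤ p)
    (hC : P C) (u : ℕ) : (S.cert C u).length ≤ p := by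
  unfold cert Config.extend
  split_ifs
  exacts [S.length_prov_le h hC _, Nat.zero_le p]

theorem of_forall_agree (S : PLS P r) (C : configs 𝒢 ℐ) (l : C.1.Node → BitString)
    (h : ∀ v : C.1.Node, ∃ C' : configs 𝒢 ℐ, P C' ∧ C'.1.net.size = C.1.net.size ∧
      (v : ℕ) ∈ C'.1.net.verts ∧
      (C.1.toNetwork l).Agree (C'.1.toNetwork (S.prov C')) v (r C.1.net.size)) : P C := by
  refine S.soundness C l fun v => ?_
  obtain ⟨C', hP, hsize, hv, hagree⟩ := h v
  have hver := S.completeness C' hP ⟨v, hv⟩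
  rw [Config.view_eq_toNetwork_view, hsize] at hver
  rwa [Config.view_eq_toNetwork_view, hagree.view_eq]

-- Each cluster takes its certificates from a configuration that looks the same around its leader.
-- Nodes whose neighbourhood meets several clusters get the same certificate from each of them,
-- because their certificates are encoded in the labels.
theorem of_forall_agree_encodes (S : PLS P fun _ => 1) {C : configs 𝒢 ℐ}
    {l : C.1.Node → BitString} {l' : (C' : configs 𝒢 ℐ) → C'.1.Node → BitString} {D t : ℕ}
    (h : ∀ v : C.1.Node, ∃ C' : configs 𝒢 ℐ, P C' ∧ C'.1.net.size = C.1.net.size ∧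
      (v : ℕ) ∈ C'.1.net.verts ∧ (C'.1.toNetwork (l' C')).Encodes D t (S.cert C') ∧
      (C.1.toNetwork l).Agree (C'.1.toNetwork (l' C')) v (4 * D + 4)) : P C := by
  choose C' hP hsize hv henc hagree using h
  set N := C.1.toNetwork l
  let N' (v : C.1.Node) : Network := (C' v).1.toNetwork (l' (C' v))
  have hleader (u : C.1.Node) : N.marked.leader D u ∈ closedBall N.graph u D :=
    N.marked.leader_mem_closedBall
  let z (u : C.1.Node) : C.1.Node :=
    ⟨N.marked.leader D u, Config.closedBall_natGraph_subset (hleader u)⟩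
  have hball (u : C.1.Node) : (u : ℕ) ∈ closedBall N.graph (z u) D :=
    mem_closedBall_comm.mp (hleader u)
  have hagz (u : C.1.Node) : N.Agree (N' (z u)) u (3 * D + 4) :=
    (hagree (z u)).recenter (hball u) (by lia)
  have hdecode {u : C.1.Node} {x : ℕ} (hx : N.Agree (N' u) x (3 * D + 3))
      (hbdry : N.marked.IsBoundary D x) : N.decode D t x = S.cert (C' u) x :=
    hx.decode_eq.trans (henc u x ((hx.mono (by lia)).isBoundary hbdry))
  have hconsistent {v x : C.1.Node} (hx : (x : ℕ) ∈ closedBall N.graph v 1) :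
      S.cert (C' (z x)) x = S.cert (C' (z v)) x := by
    obtain heq | hne := eq_or_ne (N.marked.leader D v) (N.marked.leader D x)
    · rw [show z x = z v from Subtype.ext heq.symm]
    · have hadj : N.graph.Adj v x :=
        (mem_closedBall_one.mp hx).resolve_left fun h => hne (h ▸ rfl)
      have hbdry : N.marked.IsBoundary D x := ⟨v, hadj.symm, hne⟩
      rw [← hdecode ((hagz x).mono (by lia)) hbdry,
        hdecode ((hagz v).recenter hx (by lia)) hbdry]
  refine S.of_forall_agree C (fun u => S.cert (C' (z u)) u) fun v =>
    ⟨C' (z v), hP _, hsize _, ?_, fun x hx => ?_⟩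
  · have hv' := hball v
    rw [(hagree (z v)).closedBall_eq (by lia)] at hv'
    exact Config.closedBall_natGraph_subset (v := ⟨z v, hv (z v)⟩) hv'
  · obtain ⟨hadj, hinput, -⟩ := (hagz v).mono (R' := 1) (by lia) x hx
    have hxC : x ∈ C.1.net.verts := Config.closedBall_natGraph_subset hx
    exact ⟨hadj, hinput, (Config.extend_coe (fun u => S.cert (C' (z u)) u) ⟨x, hxC⟩).trans
      (hconsistent (x := ⟨x, hxC⟩) hx)⟩

theorem exists_encodes (S : PLS P r) {C : configs 𝒢 ℐ} (hC : P C) {p t D : ℕ} (ht : 1 ≤ t)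
    (hp : S.cost C.1.net.size ≤ p) (hD : 2 * (t * (Nat.log 2 C.1.net.size + 1)) ≤ D) :
    ∃ l : C.1.Node → BitString, (∀ v, (l v).length ≤ 2 * ⌈(p : ℚ) / (t : ℚ)⌉₊) ∧
      (C.1.toNetwork l).Encodes D t (S.cert C) := by
  have hq : p ≤ t * ⌈(p : ℚ) / (t : ℚ)⌉₊ := by
    have h := Nat.le_ceil ((p : ℚ) / (t : ℚ))
    rw [div_le_iff₀' (by positivity)] at h
    exact_mod_cast h
  have hcert (u : ℕ) : (S.cert C u).length ≤ t * ⌈(p : ℚ) / (t : ℚ)⌉₊ :=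
    (S.length_cert_le hp hC u).trans hq
  obtain hq0 | hq0 := Nat.eq_zero_or_pos ⌈(p : ℚ) / (t : ℚ)⌉₊
  · refine ⟨fun _ => [], fun _ => Nat.zero_le _, Config.encodes_nil fun u => ?_⟩
    simpa [hq0] using hcert u
  · obtain ⟨l, hl, henc⟩ := C.1.exists_encodes (S.cert C) ht hD
      (Nat.lt_pow_succ_log_self one_lt_two _) hcert
    exact ⟨l, fun v => (hl v).trans (by lia), henc⟩

/-- The scheme whose verifier accepts exactly the views that occur when a configuration in `P` is
labelled by `prov`. -/
def ofProver (prov : (C : configs 𝒢 ℐ) → C.1.Node → BitString)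
    (sound : ∀ (C : configs 𝒢 ℐ) (l : C.1.Node → BitString),
      (∀ v, ∃ C', P C' ∧ ∃ v', C.1.view l (r C.1.net.size) v =
        C'.1.view (prov C') (r C'.1.net.size) v') → P C) : PLS P r where
  prov := prov
  ver w := ∃ C', P C' ∧ ∃ v', w = C'.1.view (prov C') (r C'.1.net.size) v'
  completeness C hC v := ⟨C, hC, v, rfl⟩
  soundness := sound

theorem cost_le (S : PLS P r) {b : ℕ → ℕ}
    (h : ∀ C, P C → ∀ v, (S.prov C v).length ≤ b C.1.net.size) (n : ℕ) : S.cost n ≤ b n := by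
  refine iSup_le fun C => iSup_le fun ⟨hC, hn⟩ => iSup_le fun v => ?_
  exact_mod_cast hn ▸ h C hC v

theorem exists_of_encodes (S : PLS P fun _ => 1) {D t b : ℕ → ℕ}
    (hr : ∀ n, 2 ≤ n → 4 * D n + 5 ≤ r n)
    (hl : ∀ C : configs 𝒢 ℐ, P C → ∃ l : C.1.Node → BitString,
      (∀ v, (l v).length ≤ b C.1.net.size) ∧
        (C.1.toNetwork l).Encodes (D C.1.net.size) (t C.1.net.size) (S.cert C)) :
    ∃ S' : PLS P r, ∀ n, S'.cost n ≤ b n := by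
  choose! prov hlen henc using hl
  refine ⟨ofProver prov fun C l hview => ?_, cost_le _ hlen⟩
  refine S.of_forall_agree_encodes (l := l) (l' := prov) (D := D C.1.net.size)
    (t := t C.1.net.size) fun v => ?_
  obtain ⟨C', hP, v', h⟩ := hview v
  have hsize : C.1.net.size = C'.1.net.size := congrArg View.size h
  have hcenter : (v : ℕ) = v' := congrArg View.center h
  refine ⟨C', hP, hsize.symm, hcenter ▸ v'.2, hsize ▸ henc C' hP, ?_⟩
  rw [← hsize] at h
  exact Config.agree_of_view_eq h (hr _)

end PLS

theorem theorem1_general {𝒢 : Set NetGraph} {ℐ : Set BitString} {P : configs 𝒢 ℐ → Prop}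
    {p t : ℕ → ℕ} (S₁ : PLS P fun _ => 1) (hp : ∀ n, S₁.cost n ≤ p n) (ht : ∀ n, 1 ≤ t n) :
    ∃ S : PLS P (fun n => 21 * t n * Nat.log 2 n),
      ∀ n, S.cost n ≤ ((21 * ⌈(p n : ℚ) / (t n : ℚ)⌉₊ : ℕ) : ℕ∞) := by
  have hradius (n : ℕ) (hn : 2 ≤ n) :
      4 * (2 * (t n * (Nat.log 2 n + 1))) + 5 ≤ 21 * t n * Nat.log 2 n := by
    have hlog : 1 ≤ Nat.log 2 n := Nat.log_pos one_lt_two hn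
    nlinarith [ht n, Nat.mul_le_mul (ht n) hlog, Nat.mul_le_mul_left (t n) hlog]
  refine S₁.exists_of_encodes (t := t) hradius fun C hC => ?_
  obtain ⟨l, hl, henc⟩ := S₁.exists_encodes hC (ht _) (hp _) le_rfl
  exact ⟨l, fun v => (hl v).trans (by lia), henc⟩

theorem theorem1 (c : ℕ) :
    ∃ K : ℕ, ∀ (𝒢 : Set NetGraph) (ℐ : Set BitString),
      (∀ G ∈ 𝒢, G.graph.Connected) → (∀ G ∈ 𝒢, G.IdBitsLE c) →
      ∀ (P : configs 𝒢 ℐ → Prop) (p : ℕ → ℕ),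
        (∃ S₁ : PLS P (fun _ => 1), ∀ n, S₁.cost n ≤ p n) →
        ∀ t : ℕ → ℕ, (∀ n, 1 ≤ t n) →
          ∃ S : PLS P (fun n => K * t n * Nat.log 2 n),
            ∀ n, S.cost n ≤ ((K * ⌈(p n : ℚ) / (t n : ℚ)⌉₊ : ℕ) : ℕ∞) :=
  ⟨21, fun _ _ _ _ _ _ ⟨S₁, hp⟩ _ ht => theorem1_general S₁ hp ht⟩
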